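/- A \emph{continuum} is a compact connected metrizable space with more than one point; a \emph{subcontinuum} of a continuum $Y$ is a nonempty compact connected subset of $Y$ (one-point subsets being allowed). A continuum $Y$ is \emph{indecomposable} if it is not the union of two proper subcontinua. The \emph{meager composant} of a point $x \in Y$ is the union of all subcontinua of $Y$ that contain $x$ and are nowhere dense in $Y$. A subcontinuum $K$ of $Y$ is \emph{filament} if there is a neighborhood $N$ of $K$ in $Y$ such that the connected component of $N$ containing $K$ is nowhere dense in $Y$. A subset $X \subseteq Y$ is a \emph{filament set} if every subcontinuum of $Y$ contained in $X$ is filament. A connected subset $X \subseteq Y$ is \emph{singular} in $Y$ if there is a point $y \in Y$ such that every connected $C \subseteq X$ whose closure in $Y$ contains $y$ is dense in $X$; it is \emph{singular dense} if it is singular and dense in $Y$. \textbf{Theorem.} A continuum $Y$ is indecomposable if and only if there is a point $x \in Y$ whose meager composant is both a singular dense set and a filament set. -/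

import Mathlib

namespace ContinuumTheory

variable {Y : Type*} [TopologicalSpace Y]

/-- Subcontinua of a space: nonempty compact connected subsets.
One-point sets are allowed, so that every point lies in its own meager composant. -/
def IsSubcontinuum (K : Set Y) : Prop :=
  IsCompact K ∧ IsConnected K

/-- `Y` is not the union of two proper subcontinua. -/
def IsIndecomposable (Y : Type*) [TopologicalSpace Y] : Prop :=
  ¬ ∃ H K : Set Y, IsSubcontinuum H ∧ IsSubcontinuum K ∧
    H ≠ Set.univ ∧ K ≠ Set.univ ∧ H ∪ K = Set.univ

/-- The meager composant of `x`: the union of all nowhere dense subcontinua containing `x`. -/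
def meagerComposant (x : Y) : Set Y :=
  ⋃₀ {K : Set Y | IsSubcontinuum K ∧ IsNowhereDense K ∧ x ∈ K}

/-- A subcontinuum `K` is filament if it has a neighborhood `N` such that the connected component
of `N` containing `K` is nowhere dense. As `K` is connected and nonempty, that component is
`connectedComponentIn N x` for each point `x` of `K`. -/
def IsFilament (K : Set Y) : Prop :=
  IsSubcontinuum K ∧
    ∃ N ∈ nhdsSet K, ∀ x ∈ K, IsNowhereDense (connectedComponentIn N x)

/-- Every continuum inside `X` is a filament subcontinuum of `Y`. -/
def IsFilamentSet (X : Set Y) : Prop :=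
  ∀ K : Set Y, IsSubcontinuum K → K ⊆ X → IsFilament K

/-- `X` is singular with respect to `y`: each connected `C ⊆ X` whose closure in `Y` contains `y`
is dense in `X`. The set `closure C ∩ X` is the closure of `C` in the subspace `X`. -/
def IsSingularWrt (X : Set Y) (y : Y) : Prop :=
  IsConnected X ∧
    ∀ C : Set Y, C ⊆ X → IsConnected C → y ∈ closure C → closure C ∩ X = X

/-- `X` is singular with respect to some point of `Y`. -/
def IsSingular (X : Set Y) : Prop :=
  ∃ y : Y, IsSingularWrt X y

/-- `X` is both singular and dense in `Y`. -/
def IsSingularDense (X : Set Y) : Prop :=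
  IsSingular X ∧ Dense X

end ContinuumTheory

/-! Both directions compare indecomposability with the statement that every proper subcontinuum is
nowhere dense. If `Y` is indecomposable, that statement holds; Baire category then gives a point `y`
outside the meager composant of `x`, and the composant is singular with respect to `y` because
closures of its non-dense connected subsets stay inside it. Conversely, let H be a proper
subcontinuum with interior, and p a point of the composant in that interior. Singularity makes the
union of the nowhere dense subcontinua of H through p nowhere dense, so its closure Q is the largest
of them. Since Q is filament, boundary bumping in H produces a larger one, a contradiction
(`IsSubcontinuum.isNowhereDense_of_meagerComposant`). Two nowhere dense sets cannot cover `Y`. -/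

namespace ContinuumTheory

/-! ### Connectedness after removing a connected piece -/

section Preconnected

variable {Z : Type*} [TopologicalSpace Z]

/-- If removing `A` splits the connected set `X` into the traces of the open sets `u` and `v`,
then `A` together with one of the pieces is still connected. -/
theorem isPreconnected_union_piece {X A u v : Set Z} (hX : IsPreconnected X)
    (hA : IsConnected A) (hAX : A ⊆ X) (hu : IsOpen u) (hv : IsOpen v)
    (hcover : X ⊆ A ∪ (u ∪ v)) (hdisj : X ∩ (u ∩ v) = ∅) :
    IsPreconnected (A ∪ X ∩ u) := by
  have key : ∀ s t : Set Z, IsOpen s → IsOpen t → A ∪ X ∩ u ⊆ s ∪ t →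
      (A ∪ X ∩ u) ∩ (s ∩ t) = ∅ → A ⊆ s → A ∪ X ∩ u ⊆ s := by
    intro s t hs ht hst hst' hAs
    -- With A on the side of s, a separation of A ∪ (X ∩ u) extends to one of X by adding v to that
    -- side.
    have hcov : X ⊆ (s ∪ v) ∪ (t ∩ u) := by
      intro z hz
      rcases hcover hz with h | h | h
      · exact Or.inl (Or.inl (hAs h))
      · rcases hst (Or.inr ⟨hz, h⟩) with h' | h'
        · exact Or.inl (Or.inl h')
        · exact Or.inr ⟨h', h⟩
      · exact Or.inl (Or.inr h)
    have hdis : X ∩ ((s ∪ v) ∩ (t ∩ u)) = ∅ := by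
      refine Set.eq_empty_of_forall_notMem ?_
      rintro z ⟨hz, hz' | hz', hzt, hzu⟩
      · exact Set.eq_empty_iff_forall_notMem.1 hst' z ⟨Or.inr ⟨hz, hzu⟩, hz', hzt⟩
      · exact Set.eq_empty_iff_forall_notMem.1 hdisj z ⟨hz, hzu, hz'⟩
    rcases isPreconnected_iff_subset_of_disjoint.1 hX _ _ (hs.union hv) (ht.inter hu) hcov hdis
      with h | h
    · rintro z (hz | ⟨hz, hzu⟩)
      · exact hAs hz
      · rcases h hz with h' | h'
        · exact h'
        · exact (Set.eq_empty_iff_forall_notMem.1 hdisj z ⟨hz, hzu, h'⟩).elim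
    · obtain ⟨a, ha⟩ := hA.nonempty
      exact (Set.eq_empty_iff_forall_notMem.1 hst' a
        ⟨Or.inl ha, hAs ha, (h (hAX ha)).1⟩).elim
  rw [isPreconnected_iff_subset_of_disjoint]
  intro s t hs ht hst hst'
  have hAst : A ∩ (s ∩ t) = ∅ :=
    Set.subset_eq_empty (Set.inter_subset_inter_left _ Set.subset_union_left) hst'
  rcases isPreconnected_iff_subset_of_disjoint.1 hA.isPreconnected s t hs ht
    (Set.subset_union_left.trans hst) hAst with h | h
  · exact Or.inl (key s t hs ht hst hst' h)
  · exact Or.inr (key t s ht hs (by rwa [Set.union_comm t s]) (by rwa [Set.inter_comm t s]) h)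

/-- The complement in `X` of a closed set whose trace on `X` is connected is either preconnected,
or splits into two pieces, each connected together with that trace. -/
theorem isPreconnected_diff_or_exists_split {X F : Set Z} (hX : IsPreconnected X)
    (hF : IsClosed F) (hA : IsConnected (F ∩ X)) :
    IsPreconnected (X \ F) ∨ ∃ u v : Set Z, IsOpen u ∧ IsOpen v ∧ Disjoint u F ∧ Disjoint v F ∧
      (X ∩ u).Nonempty ∧ (X ∩ v).Nonempty ∧ X ∩ (u ∩ v) = ∅ ∧ X ⊆ F ∪ (u ∪ v) ∧
      IsConnected (F ∩ X ∪ X ∩ u) ∧ IsConnected (F ∩ X ∪ X ∩ v) := by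
  refine or_iff_not_imp_left.2 fun h => ?_
  rw [isPreconnected_iff_subset_of_disjoint] at h
  push Not at h
  obtain ⟨u, v, hu, hv, huv, hdisj, hnu, hnv⟩ := h
  have hcover : X ⊆ F ∪ (u \ F ∪ v \ F) := by
    intro z hz
    by_cases hzF : z ∈ F
    · exact Or.inl hzF
    · rcases huv ⟨hz, hzF⟩ with h' | h'
      · exact Or.inr (Or.inl ⟨h', hzF⟩)
      · exact Or.inr (Or.inr ⟨h', hzF⟩)
  have hcover' : X ⊆ F ∩ X ∪ (u \ F ∪ v \ F) := fun z hz =>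
    (hcover hz).imp (fun h' => ⟨h', hz⟩) id
  have hdisj' : X ∩ (u \ F ∩ (v \ F)) = ∅ := by
    refine Set.eq_empty_of_forall_notMem ?_
    rintro z ⟨hz, ⟨hzu, hzF⟩, hzv, -⟩
    exact Set.eq_empty_iff_forall_notMem.1 hdisj z ⟨⟨hz, hzF⟩, hzu, hzv⟩
  have hu' : IsOpen (u \ F) := hu.sdiff hF
  have hv' : IsOpen (v \ F) := hv.sdiff hF
  refine ⟨u \ F, v \ F, hu', hv', Set.disjoint_sdiff_left, Set.disjoint_sdiff_left, ?_, ?_,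
    hdisj', hcover, ⟨hA.nonempty.mono Set.subset_union_left, ?_⟩,
    ⟨hA.nonempty.mono Set.subset_union_left, ?_⟩⟩
  · obtain ⟨z, ⟨hz, hzF⟩, hzv⟩ := Set.not_subset.1 hnv
    exact ⟨z, hz, (huv ⟨hz, hzF⟩).resolve_right hzv, hzF⟩
  · obtain ⟨z, ⟨hz, hzF⟩, hzu⟩ := Set.not_subset.1 hnu
    exact ⟨z, hz, (huv ⟨hz, hzF⟩).resolve_left hzu, hzF⟩
  · exact isPreconnected_union_piece hX hA Set.inter_subset_right hu' hv' hcover' hdisj'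
  · refine isPreconnected_union_piece hX hA Set.inter_subset_right hv' hu' ?_ ?_
    · rwa [Set.union_comm (v \ F)]
    · rwa [Set.inter_comm (v \ F)]

theorem isClosed_connectedComponentIn {F : Set Z} (hF : IsClosed F) (p : Z) :
    IsClosed (connectedComponentIn F p) := by
  by_cases hp : p ∈ F
  · refine isClosed_of_closure_subset <|
      isPreconnected_connectedComponentIn.closure.subset_connectedComponentIn
        (subset_closure (mem_connectedComponentIn hp))
        (closure_minimal (connectedComponentIn_subset F p) hF)
  · rw [connectedComponentIn_eq_empty hp]
    exact isClosed_empty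

end Preconnected

/-! ### Boundary bumping -/

section BoundaryBumping

variable {Z : Type*} [TopologicalSpace Z]

/-- Boundary bumping: in a compact connected Hausdorff space, a component of a proper closed set
reaches the frontier of that set. -/
theorem not_connectedComponentIn_subset_interior [CompactSpace Z] [T2Space Z]
    [PreconnectedSpace Z] {F : Set Z} (hF : IsClosed F) (hne : F ≠ Set.univ) {p : Z}
    (hp : p ∈ F) : ¬ connectedComponentIn F p ⊆ interior F := by
  intro hsub
  have : CompactSpace F := isCompact_iff_compactSpace.1 hF.isCompact
  have hcomp := connectedComponent_eq_iInter_isClopen (⟨p, hp⟩ : F)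
  have hO : IsOpen ((↑) ⁻¹' interior F : Set F) := isOpen_interior.preimage continuous_subtype_val
  -- By compactness a single relatively clopen s lies in `interior F`, and is then clopen in the
  -- whole space.
  have hcO : (⋂ s : { s : Set F // IsClopen s ∧ (⟨p, hp⟩ : F) ∈ s }, (s : Set F)) ⊆
      (↑) ⁻¹' interior F := by
    rw [← hcomp]
    intro z hz
    apply hsub
    rw [connectedComponentIn_eq_image hp]
    exact ⟨z, hz, rfl⟩
  have : Nonempty { s : Set F // IsClopen s ∧ (⟨p, hp⟩ : F) ∈ s } :=
    ⟨⟨Set.univ, isClopen_univ, trivial⟩⟩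
  obtain ⟨⟨s, hs, hps⟩, hsO⟩ := exists_subset_nhds_of_compactSpace
    (V := fun s : { s : Set F // IsClopen s ∧ (⟨p, hp⟩ : F) ∈ s } => (s : Set F))
    (fun a b => ⟨⟨a ∩ b, a.2.1.inter b.2.1, a.2.2, b.2.2⟩, Set.inter_subset_left,
      Set.inter_subset_right⟩)
    (fun a => a.2.1.isClosed) (fun z hz => hO.mem_nhds (hcO hz))
  have hclosed : IsClosed ((↑) '' s : Set Z) := hF.isClosedMap_subtype_val s hs.isClosed
  have hopen : IsOpen ((↑) '' s : Set Z) := by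
    obtain ⟨W, hW, rfl⟩ := isOpen_induced_iff.1 hs.isOpen
    convert hW.inter (isOpen_interior (s := F)) using 1
    ext z
    constructor
    · rintro ⟨z, hz, rfl⟩
      exact ⟨hz, hsO hz⟩
    · rintro ⟨hz, hz'⟩
      exact ⟨⟨z, interior_subset hz'⟩, hz, rfl⟩
  have huniv := IsClopen.eq_univ ⟨hclosed, hopen⟩ ⟨p, ⟨p, hp⟩, hps, rfl⟩
  refine hne (Set.eq_univ_of_forall fun z => ?_)
  obtain ⟨w, -, rfl⟩ := huniv.ge (Set.mem_univ z)
  exact w.2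

theorem isSubcontinuum_connectedComponentIn [CompactSpace Z] {F : Set Z} (hF : IsClosed F) {p : Z}
    (hp : p ∈ F) :
    IsSubcontinuum (connectedComponentIn F p) :=
  ⟨(isClosed_connectedComponentIn hF p).isCompact, isConnected_connectedComponentIn_iff.2 hp⟩

/-- Boundary bumping inside a subcontinuum `H`. -/
theorem exists_subcontinuum_not_subset_interior [T2Space Z] {H F : Set Z}
    (hH : IsSubcontinuum H) (hF : IsClosed F) (hHF : ¬ H ⊆ F) {p : Z} (hpH : p ∈ H) (hpF : p ∈ F) :
    ∃ C : Set Z, IsSubcontinuum C ∧ p ∈ C ∧ C ⊆ H ∧ C ⊆ F ∧ ¬ C ⊆ interior F := by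
  have : CompactSpace H := isCompact_iff_compactSpace.1 hH.1
  have : ConnectedSpace H := isConnected_iff_connectedSpace.1 hH.2
  have hF' : IsClosed ((↑) ⁻¹' F : Set H) := hF.preimage continuous_subtype_val
  have hp' : (⟨p, hpH⟩ : H) ∈ ((↑) ⁻¹' F : Set H) := hpF
  have hne : ((↑) ⁻¹' F : Set H) ≠ Set.univ := fun h =>
    hHF fun z hz => h.ge (Set.mem_univ (⟨z, hz⟩ : H))
  have hsub := isSubcontinuum_connectedComponentIn hF' hp'
  refine ⟨(↑) '' connectedComponentIn ((↑) ⁻¹' F : Set H) ⟨p, hpH⟩,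
    ⟨hsub.1.image continuous_subtype_val, hsub.2.image _ continuous_subtype_val.continuousOn⟩,
    ⟨_, mem_connectedComponentIn hp', rfl⟩, ?_, ?_, ?_⟩
  · rintro _ ⟨z, -, rfl⟩
    exact z.2
  · rintro _ ⟨z, hz, rfl⟩
    exact connectedComponentIn_subset ((↑) ⁻¹' F : Set H) _ hz
  · intro h
    refine not_connectedComponentIn_subset_interior hF' hne hp' fun z hz => ?_
    exact preimage_interior_subset_interior_preimage continuous_subtype_val (h ⟨z, hz, rfl⟩)

end BoundaryBumping

/-! ### Nowhere dense sets and meager composants -/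

section MeagerComposant

variable {Z : Type*} [TopologicalSpace Z]

theorem isNowhereDense_union {s t : Set Z} (hs : IsNowhereDense s) (ht : IsNowhereDense t) :
    IsNowhereDense (s ∪ t) := by
  unfold IsNowhereDense at *
  rw [closure_union, interior_union_isClosed_of_interior_empty isClosed_closure ht, hs]

theorem isNowhereDense_mono {s t : Set Z} (hst : s ⊆ t) (ht : IsNowhereDense t) :
    IsNowhereDense s :=
  Set.subset_eq_empty (interior_mono (closure_mono hst)) ht

theorem ne_univ_of_isNowhereDense [Nonempty Z] {s : Set Z} (hs : IsNowhereDense s) :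
    s ≠ Set.univ := by
  rintro rfl
  simp [IsNowhereDense] at hs

theorem IsSubcontinuum.union {H K : Set Z} (hH : IsSubcontinuum H) (hK : IsSubcontinuum K)
    (h : (H ∩ K).Nonempty) : IsSubcontinuum (H ∪ K) :=
  ⟨hH.1.union hK.1, hH.2.union h hK.2⟩

theorem subset_meagerComposant_of_mem {x p : Z} (hp : p ∈ meagerComposant x) {K : Set Z}
    (hK : IsSubcontinuum K) (hKn : IsNowhereDense K) (hpK : p ∈ K) : K ⊆ meagerComposant x := by
  obtain ⟨L, ⟨hL, hLn, hxL⟩, hpL⟩ := hp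
  exact Set.subset_union_left.trans <| Set.subset_sUnion_of_mem
    ⟨hK.union hL ⟨p, hpK, hpL⟩, isNowhereDense_union hKn hLn, Or.inr hxL⟩

end MeagerComposant

/-! ### Indecomposable continua -/

section Indecomposable

/-- If H had interior, `Y` would decompose: as H and the closure of its complement when the
complement is connected, and otherwise as H together with each of the two pieces of the complement.
-/
theorem IsSubcontinuum.isNowhereDense_of_isIndecomposable {Y : Type*} [TopologicalSpace Y]
    [CompactSpace Y] [ConnectedSpace Y] [T2Space Y] (hY : IsIndecomposable Y) {H : Set Y}
    (hH : IsSubcontinuum H) (hne : H ≠ Set.univ) : IsNowhereDense H := by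
  have hHc : IsClosed H := hH.1.isClosed
  rw [hHc.isNowhereDense_iff]
  by_contra hint
  obtain ⟨z, hz⟩ := Set.nonempty_iff_ne_empty.2 hint
  obtain ⟨w, hw⟩ := (Set.ne_univ_iff_exists_notMem H).1 hne
  rcases isPreconnected_diff_or_exists_split isPreconnected_univ hHc
    (by rw [Set.inter_univ]; exact hH.2) with
    h | ⟨u, v, hu, hv, huH, hvH, hun, hvn, hdisj, hcover, hcu, hcv⟩
  · rw [← Set.compl_eq_univ_sdiff] at h
    refine hY ⟨H, closure Hᶜ, hH, ⟨isClosed_closure.isCompact, ⟨⟨w, subset_closure hw⟩, h.closure⟩⟩,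
      hne, ?_, ?_⟩
    · rw [closure_compl]
      exact fun h' => h'.ge (Set.mem_univ z) hz
    · exact Set.eq_univ_of_forall fun a => (em (a ∈ H)).imp id fun h' => subset_closure h'
  · simp only [Set.univ_inter, Set.inter_univ] at hun hvn hdisj hcu hcv
    have hd : ∀ a ∈ u, a ∉ v := fun a ha hb => Set.eq_empty_iff_forall_notMem.1 hdisj a ⟨ha, hb⟩
    have hcov : ∀ a, a ∈ H ∨ a ∈ u ∨ a ∈ v := fun a => hcover (Set.mem_univ a)
    have eu : H ∪ u = vᶜ := by
      ext a
      have := hcov a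
      have := hd a
      have : a ∈ v → a ∉ H := fun h => Set.disjoint_left.1 hvH h
      simp only [Set.mem_union, Set.mem_compl_iff]
      tauto
    have ev : H ∪ v = uᶜ := by
      ext a
      have := hcov a
      have := hd a
      have : a ∈ u → a ∉ H := fun h => Set.disjoint_left.1 huH h
      simp only [Set.mem_union, Set.mem_compl_iff]
      tauto
    rw [eu] at hcu
    rw [ev] at hcv
    refine hY ⟨vᶜ, uᶜ, ⟨hv.isClosed_compl.isCompact, hcu⟩, ⟨hu.isClosed_compl.isCompact, hcv⟩,
      ?_, ?_, ?_⟩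
    · simpa [Set.compl_univ_iff] using hvn.ne_empty
    · simpa [Set.compl_univ_iff] using hun.ne_empty
    · exact Set.eq_univ_of_forall fun a => by
        by_cases ha : a ∈ u
        · exact Or.inl (hd a ha)
        · exact Or.inr ha

variable {Y : Type*} [TopologicalSpace Y] [CompactSpace Y] [ConnectedSpace Y] [T2Space Y]

theorem mem_meagerComposant_self [Nontrivial Y] (hY : IsIndecomposable Y) (x : Y) :
    x ∈ meagerComposant x := by
  have hx : IsSubcontinuum {x} := ⟨isCompact_singleton, isConnected_singleton⟩
  refine ⟨{x}, ⟨hx, hx.isNowhereDense_of_isIndecomposable hY ?_, rfl⟩, rfl⟩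
  obtain ⟨z, hz⟩ := exists_ne x
  exact fun h => hz (h.ge (Set.mem_univ z))

theorem isConnected_meagerComposant [Nontrivial Y] (hY : IsIndecomposable Y) (x : Y) :
    IsConnected (meagerComposant x) :=
  ⟨⟨x, mem_meagerComposant_self hY x⟩,
    isPreconnected_sUnion x _ (fun _ h => h.2.2) fun _ h => h.1.2.isPreconnected⟩

/-- By boundary bumping, a proper continuum from x reaches any given nonempty open set. -/
theorem dense_meagerComposant [Nontrivial Y] (hY : IsIndecomposable Y) (x : Y) :
    Dense (meagerComposant x) := by
  rw [dense_iff_inter_open]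
  rintro U hU ⟨u, hu⟩
  by_cases hxU : x ∈ U
  · exact ⟨x, hxU, mem_meagerComposant_self hY x⟩
  obtain ⟨G, hG, hGc, hGU⟩ := exists_mem_nhds_isClosed_subset (hU.mem_nhds hu)
  have hF : IsClosed (interior G)ᶜ := isOpen_interior.isClosed_compl
  have hxF : x ∈ (interior G)ᶜ := fun h => hxU (hGU (interior_subset h))
  have huF : u ∉ (interior G)ᶜ := fun h => h (mem_interior_iff_mem_nhds.2 hG)
  have hne : (interior G)ᶜ ≠ Set.univ := fun h => huF (h.ge (Set.mem_univ u))
  obtain ⟨c, hc, hc'⟩ := Set.not_subset.1 (not_connectedComponentIn_subset_interior hF hne hxF)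
  have hC := isSubcontinuum_connectedComponentIn hF hxF
  refine ⟨c, hGU ?_, connectedComponentIn (interior G)ᶜ x,
    ⟨hC, hC.isNowhereDense_of_isIndecomposable hY fun h =>
      huF (connectedComponentIn_subset _ _ (h.ge (Set.mem_univ u))),
      mem_connectedComponentIn hxF⟩, hc⟩
  rw [interior_compl, Set.notMem_compl_iff] at hc'
  exact closure_minimal interior_subset hGc hc'

/-- Each nowhere dense continuum through x misses a basic open set, so the composant lies in a
countable union of closed nowhere dense components; Baire category applies. -/
theorem exists_notMem_meagerComposant [SecondCountableTopology Y] (hY : IsIndecomposable Y)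
    (x : Y) : ∃ y, y ∉ meagerComposant x := by
  by_contra! hall
  have hcover : ⋃ U ∈ TopologicalSpace.countableBasis Y, connectedComponentIn Uᶜ x = Set.univ := by
    refine Set.eq_univ_of_forall fun y => ?_
    obtain ⟨K, ⟨hK, hKn, hxK⟩, hyK⟩ := hall y
    obtain ⟨z, hz⟩ := (Set.ne_univ_iff_exists_notMem K).1 (ne_univ_of_isNowhereDense hKn)
    obtain ⟨U, hU, -, hUK⟩ := (TopologicalSpace.isBasis_countableBasis Y).exists_subset_of_mem_open
      (show z ∈ Kᶜ from hz) hK.1.isClosed.isOpen_compl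
    exact Set.mem_biUnion hU
      (hK.2.isPreconnected.subset_connectedComponentIn hxK (Set.subset_compl_comm.1 hUK) hyK)
  obtain ⟨⟨U, hU⟩, hint⟩ := nonempty_interior_of_iUnion_of_closed
    (f := fun U : TopologicalSpace.countableBasis Y => connectedComponentIn (U : Set Y)ᶜ x)
    (fun U => isClosed_connectedComponentIn
      (TopologicalSpace.isOpen_of_mem_countableBasis U.2).isClosed_compl x)
    (by rw [← hcover, Set.biUnion_eq_iUnion])
  have hUc := (TopologicalSpace.isOpen_of_mem_countableBasis hU).isClosed_compl
  obtain ⟨w, hw⟩ := TopologicalSpace.nonempty_of_mem_countableBasis hU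
  have hxU : x ∈ Uᶜ :=
    connectedComponentIn_nonempty_iff.1 (hint.mono interior_subset)
  have hn := (isSubcontinuum_connectedComponentIn hUc hxU).isNowhereDense_of_isIndecomposable hY
    fun h => connectedComponentIn_subset _ _ (h.ge (Set.mem_univ w)) hw
  rw [(isClosed_connectedComponentIn hUc x).isNowhereDense_iff] at hn
  exact hint.ne_empty hn

theorem isSingularWrt_meagerComposant [Nontrivial Y] (hY : IsIndecomposable Y) {x y : Y}
    (hy : y ∉ meagerComposant x) : IsSingularWrt (meagerComposant x) y := by
  refine ⟨isConnected_meagerComposant hY x, fun C hCX hC hyC => ?_⟩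
  obtain ⟨c, hc⟩ := hC.nonempty
  suffices closure C = Set.univ by rw [this, Set.univ_inter]
  by_contra hne
  have hCc : IsSubcontinuum (closure C) := ⟨isClosed_closure.isCompact, hC.closure⟩
  exact hy (subset_meagerComposant_of_mem (hCX hc) hCc
    (hCc.isNowhereDense_of_isIndecomposable hY hne) (subset_closure hc) hyC)

theorem isFilament_of_isIndecomposable (hY : IsIndecomposable Y) {K : Set Y}
    (hK : IsSubcontinuum K) (hne : K ≠ Set.univ) : IsFilament K := by
  obtain ⟨w, hw⟩ := (Set.ne_univ_iff_exists_notMem K).1 hne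
  obtain ⟨V, hV, hKV, hVw⟩ := normal_exists_closure_subset hK.1.isClosed
    (isOpen_compl_singleton (x := w)) (Set.subset_compl_singleton_iff.2 hw)
  refine ⟨hK, closure V, Filter.mem_of_superset (hV.mem_nhdsSet.2 hKV) subset_closure,
    fun z hz => ?_⟩
  refine (isSubcontinuum_connectedComponentIn isClosed_closure
    (subset_closure (hKV hz))).isNowhereDense_of_isIndecomposable hY fun h => ?_
  exact hVw (connectedComponentIn_subset _ _ (h.ge (Set.mem_univ w))) rfl

end Indecomposable

/-! ### Singular dense filament composants -/

section Singular

variable {Y : Type*} [TopologicalSpace Y]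

/-- A connected subset of a singular dense set is dense or nowhere dense. -/
theorem IsSingularDense.isNowhereDense_of_not_dense {X C : Set Y} (hX : IsSingularDense X)
    (hCX : C ⊆ X) (hC : IsConnected C) (hnd : ¬ Dense C) : IsNowhereDense C := by
  obtain ⟨⟨y, hXc, hsing⟩, hXd⟩ := hX
  have hdense : ∀ B ⊆ X, IsConnected B → y ∈ closure B → Dense B := fun B hBX hB hyB => by
    have h : X ⊆ closure B := Set.inter_eq_right.1 (hsing B hBX hB hyB)
    exact Dense.of_closure (hXd.mono h)
  have hyC : y ∉ closure C := fun h => hnd (hdense C hCX hC h)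
  by_contra hint
  have hint' : (interior (closure C)).Nonempty := Set.nonempty_iff_ne_empty.2 hint
  have hA : IsConnected (closure C ∩ X) :=
    hC.subset_closure (Set.subset_inter subset_closure hCX) Set.inter_subset_left
  rcases isPreconnected_diff_or_exists_split hXc.isPreconnected isClosed_closure hA with
    h | ⟨u, v, hu, hv, huC, hvC, hun, hvn, hdisj, hcover, hcu, hcv⟩
  -- X is dense and y lies off `closure C`, so the connected remainder accumulates at y and would be
  -- dense, yet it misses the interior of `closure C`.
  · have hyB : y ∈ closure (X \ closure C) := by
      have := hXd.open_subset_closure_inter (isClosed_closure (s := C)).isOpen_compl hyC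
      rwa [Set.inter_comm] at this
    have hB := hdense _ Set.sdiff_subset ⟨closure_nonempty_iff.1 ⟨y, hyB⟩, h⟩ hyB
    obtain ⟨z, hz, hz'⟩ := hB.inter_open_nonempty _ isOpen_interior hint'
    exact hz'.2 (interior_subset hz)
  · have hsub : X ⊆ (closure C ∩ X ∪ X ∩ u) ∪ (closure C ∩ X ∪ X ∩ v) := by
      intro z hz
      rcases hcover hz with h | h | h
      · exact Or.inl (Or.inl ⟨h, hz⟩)
      · exact Or.inl (Or.inr ⟨hz, h⟩)
      · exact Or.inr (Or.inr ⟨hz, h⟩)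
    have hcl := closure_mono hsub (hXd y)
    rw [closure_union] at hcl
    -- Neither half can accumulate at y: it would be dense, but it misses the open set carrying the
    -- other half.
    have key : ∀ s t : Set Y, IsOpen t → Disjoint t (closure C) → (X ∩ t).Nonempty →
        X ∩ (s ∩ t) = ∅ → IsConnected (closure C ∩ X ∪ X ∩ s) →
        y ∉ closure (closure C ∩ X ∪ X ∩ s) := by
      intro s t ht htC htn hst hs hys
      have hd := hdense _ (Set.union_subset Set.inter_subset_right Set.inter_subset_left) hs hys
      obtain ⟨z, hzt, hz | hz⟩ := hd.inter_open_nonempty t ht (htn.mono Set.inter_subset_right)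
      · exact Set.disjoint_left.1 htC hzt hz.1
      · exact Set.eq_empty_iff_forall_notMem.1 hst z ⟨hz.1, hz.2, hzt⟩
    rcases hcl with h | h
    · exact key u v hv hvC hvn hdisj hcu h
    · exact key v u hu huC hun (by rwa [Set.inter_comm v u]) hcv h

theorem IsSubcontinuum.isNowhereDense_of_meagerComposant [CompactSpace Y] [T2Space Y] {x : Y}
    (hX : IsSingularDense (meagerComposant x)) (hfil : IsFilamentSet (meagerComposant x))
    {H : Set Y} (hH : IsSubcontinuum H) (hne : H ≠ Set.univ) : IsNowhereDense H := by
  have hHc : IsClosed H := hH.1.isClosed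
  by_contra hn
  have hint : (interior H).Nonempty := by
    rw [Set.nonempty_iff_ne_empty]
    exact fun h => hn (hHc.isNowhereDense_iff.2 h)
  obtain ⟨p, hpint, hp⟩ := hX.2.inter_open_nonempty _ isOpen_interior hint
  have hpH : p ∈ H := interior_subset hpint
  -- Filamentness of {p} serves only to show that {p} is nowhere dense, so that the family `S` below
  -- is nonempty.
  obtain ⟨-, M, hM, hMp⟩ := hfil {p} ⟨isCompact_singleton, isConnected_singleton⟩
    (Set.singleton_subset_iff.2 hp)
  have hpn : IsNowhereDense {p} := isNowhereDense_mono (Set.singleton_subset_iff.2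
    (mem_connectedComponentIn (subset_of_mem_nhdsSet hM rfl))) (hMp p rfl)
  -- The union of the nowhere dense subcontinua of `H` through `p` is itself nowhere dense.
  set S : Set (Set Y) := {K | IsSubcontinuum K ∧ IsNowhereDense K ∧ p ∈ K ∧ K ⊆ H} with hS
  have hSX : ⋃₀ S ⊆ meagerComposant x :=
    Set.sUnion_subset fun K hK => subset_meagerComposant_of_mem hp hK.1 hK.2.1 hK.2.2.1
  have hSH : ⋃₀ S ⊆ H := Set.sUnion_subset fun K hK => hK.2.2.2
  have hpS : p ∈ ⋃₀ S := ⟨{p}, ⟨⟨isCompact_singleton, isConnected_singleton⟩, hpn, rfl,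
    Set.singleton_subset_iff.2 hpH⟩, rfl⟩
  have hSc : IsConnected (⋃₀ S) :=
    ⟨⟨p, hpS⟩, isPreconnected_sUnion p _ (fun _ h => h.2.2.1) fun _ h => h.1.2.isPreconnected⟩
  have hSn : IsNowhereDense (⋃₀ S) := hX.isNowhereDense_of_not_dense hSX hSc fun hd =>
    hne (Set.eq_univ_of_univ_subset (hd.closure_eq ▸ closure_minimal hSH hHc))
  have hQ : IsSubcontinuum (closure (⋃₀ S)) := ⟨isClosed_closure.isCompact, hSc.closure⟩
  have hQX : closure (⋃₀ S) ⊆ meagerComposant x :=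
    subset_meagerComposant_of_mem hp hQ hSn.closure (subset_closure hpS)
  obtain ⟨-, N, hN, hNn⟩ := hfil _ hQ hQX
  obtain ⟨V, hV, hQV, hVN⟩ := normal_exists_closure_subset isClosed_closure isOpen_interior
    (subset_interior_iff_mem_nhdsSet.2 hN)
  have hpV : p ∈ closure V := subset_closure (hQV (subset_closure hpS))
  have hnd : ∀ K : Set Y, IsConnected K → p ∈ K → K ⊆ closure V → IsNowhereDense K :=
    fun K hK hpK hKV => isNowhereDense_mono (hK.isPreconnected.subset_connectedComponentIn hpK
      (hKV.trans (hVN.trans interior_subset))) (hNn p (subset_closure hpS))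
  obtain ⟨C, hC, hpC, hCH, hCV, hCint⟩ := exists_subcontinuum_not_subset_interior hH
    isClosed_closure (fun h => hn (hnd H hH.2 hpH h)) hpH hpV
  -- C is itself a member of `S`, hence trapped in V, although it was chosen to leave the interior
  -- of `closure V`.
  refine hCint (Set.Subset.trans ?_ (hQV.trans (interior_maximal subset_closure hV)))
  exact (Set.subset_sUnion_of_mem (show C ∈ S from ⟨hC, hnd C hC.2 hpC hCV, hpC, hCH⟩)).trans
    subset_closure

end Singular

end ContinuumTheory

/-- Here `Y` is a continuum: a compact connected metrizable space with more than one point. -/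
theorem theorem1p4 (Y : Type*) [TopologicalSpace Y] [CompactSpace Y] [ConnectedSpace Y]
    [TopologicalSpace.MetrizableSpace Y] [Nontrivial Y] :
    ContinuumTheory.IsIndecomposable Y ↔
      ∃ x : Y, ContinuumTheory.IsSingularDense (ContinuumTheory.meagerComposant x) ∧
        ContinuumTheory.IsFilamentSet (ContinuumTheory.meagerComposant x) := by
  constructor
  · intro hY
    let _ := TopologicalSpace.metrizableSpaceMetric Y
    obtain ⟨x⟩ : Nonempty Y := inferInstance
    obtain ⟨y, hy⟩ := ContinuumTheory.exists_notMem_meagerComposant hY x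
    exact ⟨x, ⟨⟨y, ContinuumTheory.isSingularWrt_meagerComposant hY hy⟩,
      ContinuumTheory.dense_meagerComposant hY x⟩, fun K hK hKX =>
      ContinuumTheory.isFilament_of_isIndecomposable hY hK fun h =>
        hy (hKX (h.ge (Set.mem_univ y)))⟩
  · rintro ⟨x, hX, hfil⟩ ⟨H, K, hH, hK, hHne, hKne, hHK⟩
    exact ContinuumTheory.ne_univ_of_isNowhereDense (ContinuumTheory.isNowhereDense_union
      (hH.isNowhereDense_of_meagerComposant hX hfil hHne)
      (hK.isNowhereDense_of_meagerComposant hX hfil hKne)) hHK
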